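/- Let $M,N$ be smooth manifolds (Hausdorff, paracompact, finite-dimensional), $h:M\to N$ and $\eta:N\to M$ diffeomorphisms, and $\nu:F\to N$ a smooth vector bundle of rank $p$. Let $((F,\nu,N),[\,,]_{F,h},(\rho,\eta))$ be a generalized Lie algebroid: $\rho:F\to TM$ is a smooth vector bundle morphism over $\eta$, and $[\,,]_{F,h}$ is a biadditive operation on the space $\Gamma(F)$ of smooth sections such that $[u,u]_{F,h}=0$, the Jacobi identity holds, and $$[u,fv]_{F,h}=f[u,v]_{F,h}+X_u(f)\,v\qquad(u,v\in\Gamma(F),\ f\in C^\infty(N)),$$ where $X_u=\Gamma(Th\circ\rho,h\circ\eta)(u)=Th\circ\rho\circ u\circ(h\circ\eta)^{-1}$, a vector field on $N$. The pull-back bundle $h^*F\to M$ carries the pull-back Lie algebroid structure. Its bracket on sections over an open set $U\subseteq M$ is local and is determined by $[u\circ h,v\circ h]_{h^*F}=[u,v]_{F,h}\circ h$. Its anchor, also local on sections, sends $u\circ h$ to the vector field $(Th)^{-1}\circ X_u\circ h=\rho\circ u\circ\eta^{-1}$ on $M$; write $\rho(S)(f)$ for the resulting derivative of a function $f$ along the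 image of a section $S$ of $h^*F$. A $1$-form on $h^*F|_U$ is a $C^\infty(U)$-linear map $\Gamma(h^*F|_U)\to C^\infty(U)$; for $1$-forms $\theta,\psi$ put $$d^{h^*F}\theta(S,T)=\rho(S)(\theta(T))-\rho(T)(\theta(S))-\theta([S,T]_{h^*F}),\qquad(\psi\wedge\theta)(S,T)=\psi(S)\theta(T)-\psi(T)\theta(S).$$ Let $E$ be an interior differential system, that is, a smooth vector subbundle of $h^*F$, of rank $r$. It is called involutive if $[S,T]_{h^*F}\in\Gamma(E)$ for all $S,T\in\Gamma(E)$. For $U$ open let $\Gamma(E^0|_U)$ be the $C^\infty(U)$-module of the $1$-forms on $h^*F|_U$ which vanish on $\Gamma(E|_U)$. Let $\mathcal A$ be an atlas of $M$ consisting of smooth charts whose domains are also domains of bundle charts of $h^*F$, and suppose that for each chart domain $U$ of $\mathcal A$ a basis $\Theta^{r+1},\dots,\Theta^p$ (depending on $U$) of the $C^\infty(U)$-module $\Gamma(E^0|_U)$ is given. Then $E$ is involutive if and only if for each chart domain $U$ of $\mathcal A$ there are $1$-forms $\Omega^\alpha_\beta$ on $h^*F|_U$ ($\alpha,\beta\in\{r+1,\dots,p\}$)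 such that $$d^{h^*F}\Theta^\alpha=\sum_{\beta=r+1}^p\Omega^\alpha_\beta\wedge\Theta^\beta,\qquad \alpha\in\{r+1,\dots,p\}.$$ -/

import Mathlib

open Bundle Manifold ContDiff Topology Set TopologicalSpace

namespace GenLie

noncomputable section

/-! ### Sections of a vector bundle over an open subset, as a module over the smooth functions -/

section Sections

variable (m : ℕ) {M : Type*} [TopologicalSpace M] [ChartedSpace (EuclideanSpace ℝ (Fin m)) M]

/-- The ring of smooth real functions on the open subset `U`. -/
abbrev SmoothFun (U : Opens M) : Type _ := C^∞⟮𝓡 m, U; 𝓘(ℝ, ℝ), ℝ⟯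

variable (p : ℕ) (W : M → Type*) [∀ x, AddCommGroup (W x)] [∀ x, Module ℝ (W x)]
  [∀ x, TopologicalSpace (W x)] [TopologicalSpace (TotalSpace (EuclideanSpace ℝ (Fin p)) W)]
  [FiberBundle (EuclideanSpace ℝ (Fin p)) W]

/-- Smoothness of a section, defined over the open subset `U`, of the vector bundle `W`. -/
def IsSmoothSection (U : Opens M) (s : ∀ x : U, W x) : Prop :=
  ContMDiff (𝓡 m) ((𝓡 m).prod 𝓘(ℝ, EuclideanSpace ℝ (Fin p))) ∞
    (fun x : U => (⟨(x : M), s x⟩ : TotalSpace (EuclideanSpace ℝ (Fin p)) W))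

theorem isSmoothSection_iff (U : Opens M) (s : ∀ x : U, W x) :
    IsSmoothSection m p W U s ↔ ∀ x₀ : U, ContMDiffAt (𝓡 m) 𝓘(ℝ, EuclideanSpace ℝ (Fin p)) ∞
      (fun x : U => (trivializationAt (EuclideanSpace ℝ (Fin p)) W (x₀ : M)
        ⟨(x : M), s x⟩).2) x₀ := by
  refine forall_congr' fun x₀ => ?_
  rw [contMDiffAt_totalSpace, and_iff_right]
  exact contMDiff_subtype_val x₀

variable [VectorBundle ℝ (EuclideanSpace ℝ (Fin p)) W]

theorem eventually_mem_baseSet (U : Opens M) (x₀ : U) :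
    ∀ᶠ x : U in 𝓝 x₀, (x : M) ∈
      (trivializationAt (EuclideanSpace ℝ (Fin p)) W (x₀ : M)).baseSet :=
  continuous_subtype_val.continuousAt.eventually
    ((trivializationAt (EuclideanSpace ℝ (Fin p)) W (x₀ : M)).open_baseSet.mem_nhds
      (mem_baseSet_trivializationAt _ W _))

/-- The additive group of smooth sections over `U` of the vector bundle `W`. -/
def localSections (U : Opens M) : AddSubgroup (∀ x : U, W x) where
  carrier := {s | IsSmoothSection m p W U s}
  zero_mem' := by
    change IsSmoothSection m p W U _
    rw [isSmoothSection_iff]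
    intro x₀
    refine (contMDiffAt_const (c := (0 : EuclideanSpace ℝ (Fin p)))).congr_of_eventuallyEq ?_
    filter_upwards [eventually_mem_baseSet p W U x₀] with x hx
    exact ((trivializationAt (EuclideanSpace ℝ (Fin p)) W (x₀ : M)).linear ℝ hx).map_zero
  add_mem' := by
    intro s t hs ht
    change IsSmoothSection m p W U _ at *
    rw [isSmoothSection_iff] at *
    intro x₀
    refine ((hs x₀).add (ht x₀)).congr_of_eventuallyEq ?_
    filter_upwards [eventually_mem_baseSet p W U x₀] with x hx
    exact ((trivializationAt (EuclideanSpace ℝ (Fin p)) W (x₀ : M)).linear ℝ hx).map_add _ _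
  neg_mem' := by
    intro s hs
    change IsSmoothSection m p W U _ at *
    rw [isSmoothSection_iff] at *
    intro x₀
    refine (hs x₀).neg.congr_of_eventuallyEq ?_
    filter_upwards [eventually_mem_baseSet p W U x₀] with x hx
    exact ((trivializationAt (EuclideanSpace ℝ (Fin p)) W (x₀ : M)).linear ℝ hx).map_neg _

/-- Multiplication of sections over `U` by smooth functions on `U`, pointwise. -/
instance (U : Opens M) : SMul (SmoothFun m U) (localSections m p W U) where
  smul f s := ⟨fun x => f x • s.1 x, by
    have hs := s.2
    change IsSmoothSection m p W U _ at hs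
    change IsSmoothSection m p W U _
    rw [isSmoothSection_iff] at *
    intro x₀
    refine ((f.contMDiff x₀).smul (hs x₀)).congr_of_eventuallyEq ?_
    filter_upwards [eventually_mem_baseSet p W U x₀] with x hx
    exact ((trivializationAt (EuclideanSpace ℝ (Fin p)) W (x₀ : M)).linear ℝ hx).map_smul _ _⟩

theorem smul_apply (U : Opens M) (f : SmoothFun m U) (s : localSections m p W U)
    (x : U) : (f • s).1 x = f x • s.1 x := rfl

instance (U : Opens M) : Module (SmoothFun m U) (localSections m p W U) where
  one_smul s := Subtype.ext <| funext fun x => one_smul ℝ (s.1 x)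
  mul_smul f g s := Subtype.ext <| funext fun x => mul_smul (f x) (g x) (s.1 x)
  smul_zero f := Subtype.ext <| funext fun x => smul_zero (f x)
  smul_add f s t := Subtype.ext <| funext fun x => smul_add (f x) (s.1 x) (t.1 x)
  add_smul f g s := Subtype.ext <| funext fun x => add_smul (f x) (g x) (s.1 x)
  zero_smul s := Subtype.ext <| funext fun x => zero_smul ℝ (s.1 x)

/-- `U` is the domain of a bundle chart of `W`: over `U` there is a smooth frame of `W`. -/
def IsBundleChartDomain (U : Opens M) : Prop :=
  ∃ t : Fin p → localSections m p W U, ∀ x : U, LinearIndependent ℝ fun a => (t a).1 x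

/-- A vector subbundle of rank `r` of `W`: a family of linear subspaces of the fibres which is
locally spanned by `r` smooth, pointwise linearly independent sections. -/
structure VectorSubbundle (r : ℕ) where
  fiber : ∀ x, Submodule ℝ (W x)
  exists_frame : ∀ x₀ : M, ∃ U : Opens M, x₀ ∈ U ∧ ∃ s : Fin r → localSections m p W U,
    ∀ x : U, LinearIndependent ℝ (fun a => (s a).1 x) ∧
      Submodule.span ℝ (range fun a => (s a).1 x) = fiber x

variable {m p W}

/-- The submodule `Γ(E|U)` of `Γ(W|U)`: the smooth sections over `U` with values in `E`. -/
def VectorSubbundle.sections {r : ℕ} (E : VectorSubbundle m p W r) (U : Opens M) :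
    Submodule (SmoothFun m U) (localSections m p W U) where
  carrier := {s | ∀ x : U, s.1 x ∈ E.fiber x}
  zero_mem' := fun x => (E.fiber x).zero_mem
  add_mem' := fun hs ht x => (E.fiber x).add_mem (hs x) (ht x)
  smul_mem' := fun f _ hs x => (E.fiber x).smul_mem (f x) (hs x)

variable (m p W)

/-- The `1`-forms over `U`: the linear forms on the module `Γ(W|U)` over the smooth functions. -/
abbrev OneForm (U : Opens M) : Type _ := Module.Dual (SmoothFun m U) (localSections m p W U)

variable {m p W}

/-- The exterior product of two `1`-forms, as a `2`-form (a function of two sections). -/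
def wedge {U : Opens M} (ψ θ : OneForm m p W U) (S T : localSections m p W U) : SmoothFun m U :=
  ψ S * θ T - ψ T * θ S

/-- The submodule `Γ(E⁰|U)` of the `1`-forms over `U` which vanish on `Γ(E|U)`. -/
def VectorSubbundle.annihilator {r : ℕ} (E : VectorSubbundle m p W r) (U : Opens M) :
    Submodule (SmoothFun m U) (OneForm m p W U) :=
  (E.sections U).dualAnnihilator

end Sections

/-! ### Generalized Lie algebroids -/

section Algebroid

variable {m n : ℕ} {M N : Type*}
  [TopologicalSpace M] [ChartedSpace (EuclideanSpace ℝ (Fin m)) M] [IsManifold (𝓡 m) ∞ M]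
  [TopologicalSpace N] [ChartedSpace (EuclideanSpace ℝ (Fin n)) N] [IsManifold (𝓡 n) ∞ N]
  (p : ℕ) (F : N → Type*) [∀ y, AddCommGroup (F y)] [∀ y, Module ℝ (F y)]
  [∀ y, TopologicalSpace (F y)] [TopologicalSpace (TotalSpace (EuclideanSpace ℝ (Fin p)) F)]
  [FiberBundle (EuclideanSpace ℝ (Fin p)) F] [VectorBundle ℝ (EuclideanSpace ℝ (Fin p)) F]

/-- The module `Γ(F)` of global smooth sections of `F`. -/
abbrev GlobalSection : Type _ := Cₛ^∞⟮𝓡 n; EuclideanSpace ℝ (Fin p), F⟯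

variable {p F} in
/-- Multiplication of a global section by a smooth function. -/
def mulSection (f : C^∞⟮𝓡 n, N; 𝓘(ℝ, ℝ), ℝ⟯) (u : GlobalSection (n := n) p F) :
    GlobalSection (n := n) p F :=
  ⟨fun y => f y • u y, f.contMDiff.smul_section u.contMDiff⟩

variable {p F} in
/-- The derivative at `y` of the function `f` on `N` along the vector field
`(Th ∘ ρ) ∘ u ∘ (h ∘ η)⁻¹` on `N`. -/
def anchorDeriv (h : M ≃ₘ⟮𝓡 m, 𝓡 n⟯ N) (η : N ≃ₘ⟮𝓡 n, 𝓡 m⟯ M)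
    (ρ : ∀ y, F y →ₗ[ℝ] TangentSpace (𝓡 m) (η y)) (u : GlobalSection (n := n) p F)
    (f : N → ℝ) (y : N) : ℝ :=
  mfderiv (𝓡 n) 𝓘(ℝ, ℝ) f (h (η (η.symm (h.symm y))))
    (mfderiv (𝓡 m) (𝓡 n) h (η (η.symm (h.symm y)))
      (ρ (η.symm (h.symm y)) (u (η.symm (h.symm y)))))

/-- A generalized Lie algebroid structure on the vector bundle `F` over `N`, for the
diffeomorphisms `η : N → M` and `h : M → N`: a vector bundle morphism `(ρ, η)` from `F` to `TM`
and a Lie bracket on `Γ(F)` which satisfies the Leibniz rule with respect to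
`Γ(Th ∘ ρ, h ∘ η)`. -/
structure GeneralizedLieAlgebroid (h : M ≃ₘ⟮𝓡 m, 𝓡 n⟯ N) (η : N ≃ₘ⟮𝓡 n, 𝓡 m⟯ M) where
  ρ : ∀ y, F y →ₗ[ℝ] TangentSpace (𝓡 m) (η y)
  contMDiff_ρ : ContMDiff ((𝓡 n).prod 𝓘(ℝ, EuclideanSpace ℝ (Fin p))) (𝓡 m).tangent ∞
    (fun v : TotalSpace (EuclideanSpace ℝ (Fin p)) F =>
      (⟨η v.1, ρ v.1 v.2⟩ : TangentBundle (𝓡 m) M))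
  bracket : GlobalSection (n := n) p F → GlobalSection (n := n) p F → GlobalSection (n := n) p F
  bracket_add : ∀ u v w, bracket u (v + w) = bracket u v + bracket u w
  add_bracket : ∀ u v w, bracket (u + v) w = bracket u w + bracket v w
  bracket_self : ∀ u, bracket u u = 0
  jacobi : ∀ u v w,
    bracket u (bracket v w) + bracket w (bracket u v) + bracket v (bracket w u) = 0
  leibniz : ∀ (u v : GlobalSection (n := n) p F) (f : C^∞⟮𝓡 n, N; 𝓘(ℝ, ℝ), ℝ⟯) (y : N),
    bracket u (mulSection f v) y = f y • bracket u v y + anchorDeriv h η ρ u f y • v y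

end Algebroid

/-! ### The pull-back Lie algebroid `h*F`, on the sections over an open subset -/

section PullbackAlgebroid

/-- The fibres of a pull-back bundle are additive groups. -/
instance pullbackAddCommGroup {B B' : Type*} (E : B → Type*) [∀ y, AddCommGroup (E y)]
    (f : B' → B) (x : B') : AddCommGroup ((f *ᵖ E) x) :=
  inferInstanceAs <| AddCommGroup (E (f x))

variable {m n : ℕ} {M N : Type*}
  [TopologicalSpace M] [ChartedSpace (EuclideanSpace ℝ (Fin m)) M] [IsManifold (𝓡 m) ∞ M]
  [TopologicalSpace N] [ChartedSpace (EuclideanSpace ℝ (Fin n)) N] [IsManifold (𝓡 n) ∞ N]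
  {p : ℕ} {F : N → Type*} [∀ y, AddCommGroup (F y)] [∀ y, Module ℝ (F y)]
  [∀ y, TopologicalSpace (F y)] [TopologicalSpace (TotalSpace (EuclideanSpace ℝ (Fin p)) F)]
  [FiberBundle (EuclideanSpace ℝ (Fin p)) F] [VectorBundle ℝ (EuclideanSpace ℝ (Fin p)) F]
  [ContMDiffVectorBundle ∞ (EuclideanSpace ℝ (Fin p)) F (𝓡 n)]
  {h : M ≃ₘ⟮𝓡 m, 𝓡 n⟯ N} {η : N ≃ₘ⟮𝓡 n, 𝓡 m⟯ M}

/-- The section `x ↦ u (h x)` over `U` of the pull-back bundle `h*F`. -/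
def pullbackSection (h : M ≃ₘ⟮𝓡 m, 𝓡 n⟯ N) (U : Opens M) (u : GlobalSection (n := n) p F) :
    localSections m p (h *ᵖ F) U :=
  ⟨fun x => u (h x), by
    refine (isSmoothSection_iff m p (h *ᵖ F) U _).2 fun x₀ => ?_
    have h1 := (contMDiffAt_section (h x₀)).1 (u.contMDiff (h x₀))
    exact ContMDiffAt.comp (f := fun x : U => h x)
      (g := fun y => (trivializationAt (EuclideanSpace ℝ (Fin p)) F (h x₀) ⟨y, u y⟩).2) x₀ h1
      ((h.contMDiff _).comp x₀ (contMDiff_subtype_val x₀))⟩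

/-- The global section `u` of `F` induces, near `x`, the section `S` of `h*F`. -/
def Induces {U : Opens M} (u : GlobalSection (n := n) p F)
    (S : localSections m p (h *ᵖ F) U) (x : U) : Prop :=
  ∀ᶠ z in 𝓝 x, S.1 z = (pullbackSection h U u).1 z

theorem exists_bump [T2Space N] (y : N) (s : Set N) (hs : s ∈ 𝓝 y) :
    ∃ φ : C^∞⟮𝓡 n, N; 𝓘(ℝ, ℝ), ℝ⟯, φ =ᶠ[𝓝 y] 1 ∧ tsupport φ ⊆ s := by
  obtain ⟨φ, -, hφ⟩ := (SmoothBumpFunction.nhds_basis_tsupport (I := 𝓡 n) y).mem_iff.1 hs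
  exact ⟨⟨φ, φ.contMDiff⟩, φ.eventuallyEq_one, hφ⟩

theorem t2Space (h : M ≃ₘ⟮𝓡 m, 𝓡 n⟯ N) [T2Space M] : T2Space N :=
  h.toHomeomorph.t2Space

theorem totalSpace_cast {y y' : N} (e : y = y') (w : F y) :
    (⟨y', e ▸ w⟩ : TotalSpace (EuclideanSpace ℝ (Fin p)) F) = ⟨y, w⟩ := by
  subst e; rfl

theorem exists_induces [T2Space M] {U : Opens M} (S : localSections m p (h *ᵖ F) U) (x : U) :
    ∃ u : GlobalSection (n := n) p F, Induces u S x := by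
  classical
  have : T2Space N := t2Space h
  let S' : ∀ z : M, F (h z) := fun z => if hz : z ∈ U then S.1 ⟨z, hz⟩ else 0
  have hS' : ∀ z : U, S' z = S.1 z := fun z => dif_pos z.2
  let s : ∀ y : N, F y := fun y => (h.apply_symm_apply y) ▸ S' (h.symm y)
  have hs : ∀ z : U, s (h z) = S.1 z := by
    intro z
    have key : ∀ (z' : M) (e : h z' = h z), z' = z → (e ▸ S' z' : F (h z)) = S.1 z := by
      intro z' e hz; subst hz; exact hS' z
    exact key _ _ (h.symm_apply_apply z)
  have hopen : IsOpen (h.symm ⁻¹' (U : Set M)) := U.isOpen.preimage h.symm.continuous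
  have hsm : ContMDiffOn (𝓡 n) ((𝓡 n).prod 𝓘(ℝ, EuclideanSpace ℝ (Fin p))) ∞
      (fun y => (⟨y, s y⟩ : TotalSpace (EuclideanSpace ℝ (Fin p)) F)) (h.symm ⁻¹' (U : Set M)) := by
    intro y hy
    refine ContMDiffAt.contMDiffWithinAt ?_
    rw [contMDiffAt_section]
    have h1 := (isSmoothSection_iff m p (h *ᵖ F) U S.1).1 S.2 ⟨h.symm y, hy⟩
    let G : M → EuclideanSpace ℝ (Fin p) := fun z =>
      (trivializationAt (EuclideanSpace ℝ (Fin p)) F (h (h.symm y)) ⟨h z, S' z⟩).2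
    have h2 : ContMDiffAt (𝓡 m) 𝓘(ℝ, EuclideanSpace ℝ (Fin p)) ∞ (fun z : U => G z)
        ⟨h.symm y, hy⟩ := by
      refine h1.congr_of_eventuallyEq (Filter.Eventually.of_forall fun z => ?_)
      change (trivializationAt (EuclideanSpace ℝ (Fin p)) F (h (h.symm y)) ⟨h z, S' z⟩).2 = _
      rw [hS']
      rfl
    rw [contMDiffAt_subtype_iff] at h2
    have h3 := h2.comp y (h.symm.contMDiff y)
    refine h3.congr_of_eventuallyEq (Filter.Eventually.of_forall fun y' => ?_)
    change (trivializationAt (EuclideanSpace ℝ (Fin p)) F y ⟨y', s y'⟩).2 =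
      (trivializationAt (EuclideanSpace ℝ (Fin p)) F (h (h.symm y))
        ⟨h (h.symm y'), S' (h.symm y')⟩).2
    rw [totalSpace_cast, h.apply_symm_apply y]
  obtain ⟨φ, hφ1, hφ2⟩ := exists_bump (n := n) (h x) (h.symm ⁻¹' (U : Set M))
    (hopen.mem_nhds (by simp))
  refine ⟨⟨fun y => φ y • s y,
    ContMDiffOn.smul_section_of_tsupport φ.contMDiff.contMDiffOn hopen hφ2 hsm⟩, ?_⟩
  have : ∀ᶠ z : U in 𝓝 x, φ (h z) = 1 :=
    (h.continuous.comp continuous_subtype_val).continuousAt.eventually hφ1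
  filter_upwards [this] with z hz
  change S.1 z = φ (h z) • s (h z)
  rw [hz, hs]
  exact (one_smul ℝ _).symm

namespace GeneralizedLieAlgebroid

variable (A : GeneralizedLieAlgebroid p F h η)

theorem bracket_zero (u) : A.bracket u 0 = 0 := by
  have := A.bracket_add u 0 0
  simpa using this

theorem bracket_skew (u v) : A.bracket u v = -A.bracket v u := by
  have := A.bracket_self (u + v)
  rw [A.bracket_add, A.add_bracket, A.add_bracket, A.bracket_self, A.bracket_self] at this
  rw [eq_neg_iff_add_eq_zero]
  simpa [add_comm] using this

theorem bracket_neg (u v) : A.bracket u (-v) = -A.bracket u v := by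
  rw [eq_neg_iff_add_eq_zero, ← A.bracket_add, neg_add_cancel, bracket_zero]

theorem bracket_eq_zero [T2Space N] (u v : GlobalSection (n := n) p F) (y : N)
    (hv : ∀ᶠ z in 𝓝 y, v z = 0) : A.bracket u v y = 0 := by
  obtain ⟨φ, hφ1, hφ2⟩ := exists_bump (n := n) y _ hv
  have h0 : mulSection φ v = 0 := by
    ext z
    change φ z • v z = 0
    by_cases hz : z ∈ tsupport φ
    · rw [show v z = 0 from hφ2 hz, smul_zero]
    · rw [image_eq_zero_of_notMem_tsupport hz, zero_smul]
  have := A.leibniz u v φ y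
  rw [h0, A.bracket_zero, hv.self_of_nhds, smul_zero, add_zero, hφ1.self_of_nhds] at this
  simpa using this.symm

theorem bracket_congr [T2Space N] {u u' v v' : GlobalSection (n := n) p F} {y : N}
    (hu : ∀ᶠ z in 𝓝 y, u z = u' z) (hv : ∀ᶠ z in 𝓝 y, v z = v' z) :
    A.bracket u v y = A.bracket u' v' y := by
  have h1 : ∀ a b b' : GlobalSection (n := n) p F, (∀ᶠ z in 𝓝 y, b z = b' z) →
      A.bracket a b y = A.bracket a b' y := by
    intro a b b' hb
    have := A.bracket_eq_zero a (b + -b') y (hb.mono fun z hz => by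
      change b z + -b' z = 0
      rw [hz, add_neg_cancel])
    rw [A.bracket_add, A.bracket_neg] at this
    exact sub_eq_zero.1 ((sub_eq_add_neg _ _).trans this)
  rw [h1 u v v' hv, A.bracket_skew u, A.bracket_skew u']
  exact congrArg Neg.neg (h1 v' u u' hu)

end GeneralizedLieAlgebroid

theorem Induces.eventually {U : Opens M} {u v : GlobalSection (n := n) p F}
    {S : localSections m p (h *ᵖ F) U} {x : U} (hu : Induces u S x) (hv : Induces v S x) :
    ∀ᶠ y in 𝓝 (h x), u y = v y := by
  have h1 : ∀ᶠ z : U in 𝓝 x, u (h z) = v (h z) := by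
    filter_upwards [hu, hv] with z hz hz' using hz.symm.trans hz'
  have h2 : ∀ᶠ z in 𝓝 (x : M), u (h z) = v (h z) := by
    rw [← U.isOpen.isOpenEmbedding_subtypeVal.map_nhds_eq x]
    exact h1
  have h3 : 𝓝 (h x) = Filter.map h (𝓝 (x : M)) := (h.toHomeomorph.map_nhds_eq x).symm
  rw [h3]
  exact h2

theorem exists_section_eq [T2Space N] (y : N) (w : F y) :
    ∃ v : GlobalSection (n := n) p F, v y = w := by
  obtain ⟨s, hs, hsm⟩ := FiberBundle.exists_contMDiffOn_extend (k := ∞) (𝓡 n)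
    (EuclideanSpace ℝ (Fin p)) w
  obtain ⟨φ, hφ1, hφ2⟩ := exists_bump (n := n) y (interior s) (interior_mem_nhds.2 hs)
  refine ⟨⟨fun z => φ z • FiberBundle.extend (EuclideanSpace ℝ (Fin p)) w z,
    ContMDiffOn.smul_section_of_tsupport φ.contMDiff.contMDiffOn isOpen_interior hφ2
      (hsm.mono interior_subset)⟩, ?_⟩
  change φ y • FiberBundle.extend (EuclideanSpace ℝ (Fin p)) w y = w
  rw [hφ1.self_of_nhds, FiberBundle.extend_apply_self]
  exact one_smul ℝ _

theorem exists_smooth_germ [T2Space M] {U : Opens M} (f : SmoothFun m U) (x : U) :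
    ∃ g : C^∞⟮𝓡 m, M; 𝓘(ℝ, ℝ), ℝ⟯, ∀ᶠ z in 𝓝 (x : M), Function.extend Subtype.val f 0 z = g z := by
  obtain ⟨φ, hφ1, hφ2⟩ := exists_bump (n := m) (x : M) (U : Set M) (U.isOpen.mem_nhds x.2)
  have hf : ∀ z : U, Function.extend Subtype.val f 0 (z : M) = f z :=
    fun z => Subtype.val_injective.extend_apply _ _ _
  refine ⟨⟨fun z => φ z • Function.extend Subtype.val f 0 z, ?_⟩, ?_⟩
  · refine contMDiff_of_tsupport fun z hz => ?_
    have hz' : z ∈ U := hφ2 (closure_mono (Function.support_smul_subset_left _ _) hz)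
    refine (φ.contMDiff z).smul ?_
    have := (contMDiffAt_subtype_iff (I := 𝓡 m) (I' := 𝓘(ℝ, ℝ)) (n := ∞)
      (f := Function.extend Subtype.val f 0) (x := (⟨z, hz'⟩ : U))).1
      (by simpa only [hf] using f.contMDiff ⟨z, hz'⟩)
    exact this
  · filter_upwards [hφ1] with z hz
    change _ = φ z • Function.extend Subtype.val f 0 z
    rw [hz]
    exact (one_smul ℝ _).symm

namespace GeneralizedLieAlgebroid

variable (A : GeneralizedLieAlgebroid p F h η)

/-- For a section `S` of `h*F` induced by the global section `u` of `F`, the derivative at `x` of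
the function `f` on `M` along the vector field `ρ ∘ u ∘ η⁻¹` on `M`, the image of `S` under the
anchor of the pull-back Lie algebroid `h*F`. -/
def pullbackAnchorDeriv (u : GlobalSection (n := n) p F) (f : M → ℝ) (x : M) : ℝ :=
  mfderiv (𝓡 m) 𝓘(ℝ, ℝ) f (η (η.symm x)) (A.ρ (η.symm x) (u (η.symm x)))

theorem anchorDeriv_eq (u : GlobalSection (n := n) p F) (g : C^∞⟮𝓡 n, N; 𝓘(ℝ, ℝ), ℝ⟯) (x : M) :
    anchorDeriv h η A.ρ u g (h x) = A.pullbackAnchorDeriv u (fun z => g (h z)) x := by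
  unfold anchorDeriv pullbackAnchorDeriv
  rw [h.symm_apply_apply]
  have h1 := mfderiv_comp (I := 𝓡 m) (I' := 𝓡 n) (I'' := 𝓘(ℝ, ℝ)) (η (η.symm x)) (g := g) (f := h)
    (g.contMDiff.mdifferentiable (by simp) _) (h.contMDiff.mdifferentiable (by simp) _)
  exact (congrArg (fun L => L (A.ρ (η.symm x) (u (η.symm x)))) h1).symm

theorem pullbackAnchorDeriv_eq_zero [T2Space M] {u : GlobalSection (n := n) p F} {x : M}
    (hu : ∀ᶠ y in 𝓝 (h x), u y = 0) (f : C^∞⟮𝓡 m, M; 𝓘(ℝ, ℝ), ℝ⟯) :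
    A.pullbackAnchorDeriv u f x = 0 := by
  have : T2Space N := t2Space h
  by_cases hp : ∃ w : F (h x), w ≠ 0
  · obtain ⟨w, hw⟩ := hp
    obtain ⟨v, hv⟩ := exists_section_eq (n := n) (p := p) (h x) w
    let g : C^∞⟮𝓡 n, N; 𝓘(ℝ, ℝ), ℝ⟯ := ⟨fun y => f (h.symm y), f.contMDiff.comp h.symm.contMDiff⟩
    have h0 : ∀ w : GlobalSection (n := n) p F, A.bracket u w (h x) = 0 := by
      intro w
      rw [A.bracket_skew]
      have := A.bracket_eq_zero w u (h x) hu
      change -(A.bracket w u (h x)) = 0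
      rw [this, neg_zero]
    have h1 := A.leibniz u v g (h x)
    rw [h0, h0, smul_zero, zero_add, A.anchorDeriv_eq, hv] at h1
    have h2 := (smul_eq_zero.1 h1.symm).resolve_right hw
    have h3 : (fun z => g (h z)) = f := funext fun z => congrArg f (h.symm_apply_apply z)
    rwa [h3] at h2
  · push Not at hp
    let e := (trivializationAt (EuclideanSpace ℝ (Fin p)) F (h x)).continuousLinearEquivAt ℝ (h x)
      (mem_baseSet_trivializationAt _ F _)
    let e' := (trivializationAt (EuclideanSpace ℝ (Fin p)) F (η.symm x)).continuousLinearEquivAt ℝ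
      (η.symm x) (mem_baseSet_trivializationAt _ F _)
    have h1 : u (η.symm x) = 0 := by
      have h2 := hp (e.symm (e' (u (η.symm x))))
      rwa [map_eq_zero_iff _ e.symm.injective, map_eq_zero_iff _ e'.injective] at h2
    unfold pullbackAnchorDeriv
    rw [h1, map_zero, map_zero]
    rfl

theorem pullbackAnchorDeriv_congr [T2Space M] {u v : GlobalSection (n := n) p F} {x : M}
    (huv : ∀ᶠ y in 𝓝 (h x), u y = v y) {f g : M → ℝ} (hfg : f =ᶠ[𝓝 x] g)
    (hg : ContMDiff (𝓡 m) 𝓘(ℝ, ℝ) ∞ g) :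
    A.pullbackAnchorDeriv u f x = A.pullbackAnchorDeriv v g x := by
  have h1 := A.pullbackAnchorDeriv_eq_zero (u := u - v) (x := x) (huv.mono fun y hy => by
      change u y - v y = 0
      rw [hy, sub_self]) ⟨g, hg⟩
  have h2 : mfderiv (𝓡 m) 𝓘(ℝ, ℝ) f (η (η.symm x)) = mfderiv (𝓡 m) 𝓘(ℝ, ℝ) g (η (η.symm x)) :=
    Filter.EventuallyEq.mfderiv_eq (by rwa [η.apply_symm_apply])
  have h3 : A.pullbackAnchorDeriv u f x = A.pullbackAnchorDeriv u g x :=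
    congrArg (fun L : EuclideanSpace ℝ (Fin m) →L[ℝ] ℝ => L (A.ρ (η.symm x) (u (η.symm x)))) h2
  have h4 : A.pullbackAnchorDeriv (u - v) g x =
      A.pullbackAnchorDeriv u g x - A.pullbackAnchorDeriv v g x := by
    have h5 : A.ρ (η.symm x) ((u - v) (η.symm x)) =
        A.ρ (η.symm x) (u (η.symm x)) - A.ρ (η.symm x) (v (η.symm x)) := map_sub _ _ _
    exact (congrArg (mfderiv (𝓡 m) 𝓘(ℝ, ℝ) g (η (η.symm x))) h5).trans (map_sub _ _ _)
  rw [h3]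
  exact sub_eq_zero.1 (h4.symm.trans h1)

theorem contMDiff_pullbackAnchorDeriv (u : GlobalSection (n := n) p F)
    (g : C^∞⟮𝓡 m, M; 𝓘(ℝ, ℝ), ℝ⟯) :
    ContMDiff (𝓡 m) 𝓘(ℝ, ℝ) ∞ (A.pullbackAnchorDeriv u g) := by
  have h1 := g.contMDiff.contMDiff_tangentMap (m := ∞) (by simp)
  have h2 := (contMDiff_snd_tangentBundle_modelSpace ℝ 𝓘(ℝ, ℝ) (n := ∞)).comp
    (h1.comp (A.contMDiff_ρ.comp (u.contMDiff.comp η.symm.contMDiff)))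
  exact h2

/-- The value at `x` of the bracket of the sections `S`, `T` over `U` of `h*F`: the bracket of two
global sections of `F` which induce `S` and `T` near `x`. -/
def bracketAt [T2Space M] {U : Opens M} (S T : localSections m p (h *ᵖ F) U) (x : U) :
    (h *ᵖ F) (x : M) :=
  (pullbackSection h U
    (A.bracket (exists_induces S x).choose (exists_induces T x).choose)).1 x

theorem bracketAt_eq [T2Space M] {U : Opens M} {u v : GlobalSection (n := n) p F}
    {S T : localSections m p (h *ᵖ F) U} {x : U} (hu : Induces u S x) (hv : Induces v T x) :
    A.bracketAt S T x = (pullbackSection h U (A.bracket u v)).1 x := by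
  have : T2Space N := t2Space h
  exact A.bracket_congr (Induces.eventually (exists_induces S x).choose_spec hu)
    (Induces.eventually (exists_induces T x).choose_spec hv)

/-- The bracket of the pull-back Lie algebroid `h*F` on the sections over `U`. -/
def localBracket [T2Space M] (U : Opens M) (S T : localSections m p (h *ᵖ F) U) :
    localSections m p (h *ᵖ F) U :=
  ⟨fun x => A.bracketAt S T x, by
    intro x
    obtain ⟨u, hu⟩ := exists_induces S x
    obtain ⟨v, hv⟩ := exists_induces T x
    refine ((pullbackSection h U (A.bracket u v)).2 x).congr_of_eventuallyEq ?_
    filter_upwards [hu.eventually_nhds, hv.eventually_nhds] with z hz hz'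
    rw [A.bracketAt_eq hz hz']⟩

/-- The action of a section `S` over `U` of the pull-back Lie algebroid `h*F` on a smooth function
`f` on `U`, through the anchor of `h*F`. -/
def localAnchor [T2Space M] (U : Opens M) (S : localSections m p (h *ᵖ F) U) (f : SmoothFun m U) :
    SmoothFun m U :=
  ⟨fun x => A.pullbackAnchorDeriv (exists_induces S x).choose (Function.extend Subtype.val f 0) x,
    by
    intro x
    obtain ⟨u, hu⟩ := exists_induces S x
    obtain ⟨g, hg⟩ := exists_smooth_germ f x
    have h1 : ContMDiffAt (𝓡 m) 𝓘(ℝ, ℝ) ∞ (fun z : U => A.pullbackAnchorDeriv u g z) x :=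
      contMDiffAt_subtype_iff.2 (A.contMDiff_pullbackAnchorDeriv u g x)
    refine h1.congr_of_eventuallyEq ?_
    filter_upwards [hu.eventually_nhds,
      continuous_subtype_val.continuousAt.eventually hg.eventually_nhds] with z hz hz'
    exact A.pullbackAnchorDeriv_congr
      (Induces.eventually (exists_induces S z).choose_spec hz) hz' g.contMDiff⟩

theorem localBracket_apply [T2Space M] {U : Opens M} {u v : GlobalSection (n := n) p F}
    {S T : localSections m p (h *ᵖ F) U} {x : U} (hu : Induces u S x) (hv : Induces v T x) :
    (A.localBracket U S T).1 x = (pullbackSection h U (A.bracket u v)).1 x :=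
  A.bracketAt_eq hu hv

theorem localAnchor_apply [T2Space M] {U : Opens M} {u : GlobalSection (n := n) p F}
    {S : localSections m p (h *ᵖ F) U} {f : SmoothFun m U} {g : M → ℝ} {x : U}
    (hu : Induces u S x) (hg : ContMDiff (𝓡 m) 𝓘(ℝ, ℝ) ∞ g)
    (hfg : Function.extend Subtype.val f 0 =ᶠ[𝓝 (x : M)] g) :
    A.localAnchor U S f x = A.pullbackAnchorDeriv u g x :=
  A.pullbackAnchorDeriv_congr (Induces.eventually (exists_induces S x).choose_spec hu) hfg hg

/-- The differential of a `1`-form over `U` of the pull-back Lie algebroid `h*F`, as a `2`-form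
(a function of two sections over `U`):
`dθ (S, T) = ρ(S) (θ T) - ρ(T) (θ S) - θ [S, T]`. -/
def extDeriv [T2Space M] (U : Opens M) (θ : OneForm m p (h *ᵖ F) U)
    (S T : localSections m p (h *ᵖ F) U) : SmoothFun m U :=
  A.localAnchor U S (θ T) - A.localAnchor U T (θ S) - θ (A.localBracket U S T)

/-- The vector subbundle `E` of `h*F` (an interior differential system) is involutive:
`[S, T] ∈ Γ(E)` for all global sections `S, T ∈ Γ(E)`. -/
def Involutive [T2Space M] {r : ℕ} (E : VectorSubbundle m p (h *ᵖ F) r) : Prop :=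
  ∀ S ∈ E.sections ⊤, ∀ T ∈ E.sections ⊤, A.localBracket ⊤ S T ∈ E.sections ⊤

end GeneralizedLieAlgebroid
end PullbackAlgebroid

end

end GenLie

/-!
Everything reduces to linear algebra over the ring of smooth functions on a bundle chart domain `U`.
In a frame of `h*F` over `U`, the fibrewise orthogonal projection onto `E` is smooth, because the
Gram matrix of a local frame of `E` is invertible. So `Γ(E|U)` is a direct summand of the free
module `Γ(h*F|U)` and the quotient is reflexive. Hence a basis `Θ` of the annihilator has a dual
family of sections, and `Γ(E|U)` is the common kernel of the forms `Θ α`.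

For `S`, `T` in this common kernel `dΘ α (S, T) = -Θ α [S, T]`, so `Γ(E|U)` is closed under the
bracket if and only if every `dΘ α` vanishes on it. As `dΘ α` is bilinear over the smooth functions
and alternating, this means that `dΘ α` lies in the ideal generated by the `Θ β`. The factor `½` in
the forms `Ω α β` accounts for the pairs of vectors of the dual family, which are counted twice.

The bracket is local and bump functions extend germs of sections of `E`, so that involutivity can be
checked on the members of an open cover.
-/

namespace GenLie

section Algebra

variable {R Γ ι : Type*} [CommRing R] [AddCommGroup Γ] [Module R Γ]

theorem exists_eq_sum_mul_sub_mul [Fintype ι] [DecidableEq ι] [Invertible (2 : R)]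
    {B : Γ →ₗ[R] Γ →ₗ[R] R} (hskew : ∀ S T, B S T = -B T S)
    {θ : ι → Module.Dual R Γ} {e : ι → Γ} (he : ∀ α β, θ α (e β) = if α = β then 1 else 0)
    (hB : ∀ S T, (∀ α, θ α S = 0) → (∀ α, θ α T = 0) → B S T = 0) :
    ∃ Ω : ι → Module.Dual R Γ, ∀ S T, B S T = ∑ β, (Ω β S * θ β T - Ω β T * θ β S) := by
  let proj : Γ →ₗ[R] Γ := ∑ β, (θ β).smulRight (e β)
  have proj_apply (S : Γ) : proj S = ∑ β, θ β S • e β := by simp [proj]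
  have θ_sub_proj (S : Γ) (α : ι) : θ α (S - proj S) = 0 := by simp [proj_apply, he]
  let κ : Γ →ₗ[R] Γ := LinearMap.id - ⅟(2 : R) • proj
  refine ⟨fun β => B.flip (e β) ∘ₗ κ, fun S T => ?_⟩
  have sum_eq (S T : Γ) : ∑ β, (B.flip (e β) ∘ₗ κ) S * θ β T = B (κ S) (proj T) := by
    simp [proj_apply, mul_comm]
  have h_ker : B (S - proj S) (T - proj T) = 0 := hB _ _ (θ_sub_proj S) (θ_sub_proj T)
  have h_half : 2 * ⅟(2 : R) = 1 := mul_invOf_self 2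
  rw [Finset.sum_sub_distrib, sum_eq, sum_eq]
  simp only [κ, map_sub, map_smul, LinearMap.sub_apply, LinearMap.smul_apply, LinearMap.id_apply,
    smul_eq_mul] at h_ker ⊢
  linear_combination h_ker + hskew (proj S) T - ⅟(2 : R) * hskew (proj T) (proj S)
    + B (proj S) (proj T) * h_half

variable {E : Submodule R Γ}

theorem isReflexive_quotient_of_isProj [Module.IsReflexive R Γ] {Q : Γ →ₗ[R] Γ}
    (hQ : LinearMap.IsProj E Q) : Module.IsReflexive R (Γ ⧸ E) := by
  refine .of_split (E.liftQ (LinearMap.id - Q) fun S hS => ?_) E.mkQ ?_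
  · simp [hQ.map_id S hS]
  · ext S
    simp [Submodule.Quotient.mk_sub, (Submodule.Quotient.mk_eq_zero E).2 (hQ.map_mem S)]

theorem exists_dual_family_of_basis_dualAnnihilator [Module.IsReflexive R (Γ ⧸ E)]
    [DecidableEq ι] (Θ : Module.Basis ι R E.dualAnnihilator) :
    ∃ e : ι → Γ, ∀ α β, (Θ α).1 (e β) = if α = β then 1 else 0 := by
  let Θ' : Module.Basis ι R (Module.Dual R (Γ ⧸ E)) := Θ.map E.dualQuotEquivDualAnnihilator.symm
  choose e he using fun β => E.mkQ_surjective ((Module.evalEquiv R (Γ ⧸ E)).symm (Θ'.coord β))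
  refine ⟨e, fun α β => ?_⟩
  calc (Θ α).1 (e β) = Θ' α (E.mkQ (e β)) := rfl
    _ = Θ'.coord β (Θ' α) := by rw [he, Module.apply_evalEquiv_symm_apply]
    _ = if α = β then 1 else 0 := by
      rw [Module.Basis.coord_apply, Module.Basis.repr_self, Finsupp.single_apply]

theorem mem_iff_forall_basis_dualAnnihilator_eq_zero [Module.IsReflexive R (Γ ⧸ E)]
    (Θ : Module.Basis ι R E.dualAnnihilator) {S : Γ} : S ∈ E ↔ ∀ α, (Θ α).1 S = 0 := by
  refine ⟨fun hS α => (Submodule.mem_dualAnnihilator _).1 (Θ α).2 S hS, fun hS => ?_⟩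
  have h_eval : Module.Dual.eval R (Γ ⧸ E) (E.mkQ S) = 0 :=
    (Θ.map E.dualQuotEquivDualAnnihilator.symm).ext fun α => hS α
  rw [← Submodule.Quotient.mk_eq_zero]
  exact (Module.bijective_dual_eval R (Γ ⧸ E)).injective (h_eval.trans (map_zero _).symm)

end Algebra

section SmoothProjection

variable {𝕜 : Type*} [NontriviallyNormedField 𝕜]
  {E₀ : Type*} [NormedAddCommGroup E₀] [NormedSpace 𝕜 E₀] {H : Type*} [TopologicalSpace H]
  {I : ModelWithCorners 𝕜 E₀ H} {X : Type*} [TopologicalSpace X] [ChartedSpace H X]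
  {n : WithTop ℕ∞} {x₀ : X}

theorem contMDiffAt_of_clm_apply {V V' : Type*} [NormedAddCommGroup V] [NormedSpace 𝕜 V]
    [CompleteSpace V] [NormedAddCommGroup V'] [NormedSpace 𝕜 V'] {A : X → V →L[𝕜] V'} {c : X → V}
    (hA : ContMDiffAt I 𝓘(𝕜, V →L[𝕜] V') n A x₀) (hinv : (A x₀).IsInvertible)
    (hAc : ContMDiffAt I 𝓘(𝕜, V') n (fun x => A x (c x)) x₀) :
    ContMDiffAt I 𝓘(𝕜, V) n c x₀ := by
  have h_inverse : ContMDiffAt I 𝓘(𝕜, V' →L[𝕜] V) n (fun x => (A x).inverse) x₀ :=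
    hinv.contDiffAt_map_inverse.contMDiffAt.comp x₀ hA
  refine (h_inverse.clm_apply hAc).congr_of_eventuallyEq ?_
  obtain ⟨e, he⟩ := hinv
  filter_upwards [hA.continuousAt.eventually (he ▸ e.nhds)] with x ⟨e', he'⟩
  simp [← he']

end SmoothProjection

section SmoothProjection

variable {E₀ : Type*} [NormedAddCommGroup E₀] [NormedSpace ℝ E₀] {H : Type*} [TopologicalSpace H]
  {I : ModelWithCorners ℝ E₀ H} {X : Type*} [TopologicalSpace X] [ChartedSpace H X]
  {n : WithTop ℕ∞} {x₀ : X}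
  {V V' : Type*} [NormedAddCommGroup V] [InnerProductSpace ℝ V] [FiniteDimensional ℝ V]
  [NormedAddCommGroup V'] [InnerProductSpace ℝ V'] [CompleteSpace V']

theorem contMDiffAt_starProjection_range {A : X → V →L[ℝ] V'} {w : X → V'}
    (hA : ContMDiffAt I 𝓘(ℝ, V →L[ℝ] V') n A x₀) (hinj : Function.Injective (A x₀))
    (hw : ContMDiffAt I 𝓘(ℝ, V') n w x₀) :
    ContMDiffAt I 𝓘(ℝ, V') n (fun x => (A x).range.starProjection (w x)) x₀ := by
  have : CompleteSpace V := FiniteDimensional.complete ℝ V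
  choose c hc using fun x => (A x).range.starProjection_apply_mem (w x)
  have h_adjoint : ContMDiffAt I 𝓘(ℝ, V' →L[ℝ] V) n (fun x => (A x).adjoint) x₀ :=
    (ContinuousLinearMap.adjoint (𝕜 := ℝ) (E := V)
      (F := V')).toContinuousLinearEquiv.contDiff.contMDiff.contMDiffAt.comp x₀ hA
  have normal_equation (x : X) : ((A x).adjoint ∘L A x) (c x) = (A x).adjoint (w x) := by
    have h_ker : w x - (A x).range.starProjection (w x) ∈ (A x).adjoint.ker :=
      (A x).orthogonal_range ▸ Submodule.sub_starProjection_mem_orthogonal (w x)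
    rw [ContinuousLinearMap.comp_apply, eq_comm, ← sub_eq_zero, ← map_sub]
    exact hc x ▸ h_ker
  have h_invertible : ((A x₀).adjoint ∘L A x₀).IsInvertible :=
    ⟨(LinearEquiv.ofInjectiveEndo ((A x₀).adjoint ∘L A x₀).toLinearMap <|
      (A x₀).adjoint_comp_self_injective_iff.2 hinj).toContinuousLinearEquiv, rfl⟩
  have h_c : ContMDiffAt I 𝓘(ℝ, V) n c x₀ :=
    contMDiffAt_of_clm_apply (h_adjoint.clm_comp hA) h_invertible
      (by simpa only [normal_equation] using h_adjoint.clm_apply hw)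
  exact (hA.clm_apply h_c).congr_of_eventuallyEq (.of_forall fun x => (hc x).symm)

end SmoothProjection

noncomputable section LinearCombination

variable {E₀ : Type*} [NormedAddCommGroup E₀] [NormedSpace ℝ E₀] {H : Type*} [TopologicalSpace H]
  {I : ModelWithCorners ℝ E₀ H} {X : Type*} [TopologicalSpace X] [ChartedSpace H X]
  {n : WithTop ℕ∞} {x₀ : X} {V ι : Type*} [NormedAddCommGroup V] [NormedSpace ℝ V] [Fintype ι]

/-- The continuous linear map `c ↦ ∑ i, c i • f i` with values in the span of a finite family `f`.
The coefficients carry the Euclidean norm, so that the map has an adjoint when `V` is a Hilbert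
space. -/
def linearCombinationL (f : ι → V) : EuclideanSpace ℝ ι →L[ℝ] V :=
  ∑ i, (EuclideanSpace.proj i).smulRight (f i)

theorem linearCombinationL_apply (f : ι → V) (c : EuclideanSpace ℝ ι) :
    linearCombinationL f c = ∑ i, c i • f i := by
  simp [linearCombinationL]

theorem linearCombinationL_injective {f : ι → V} (hf : LinearIndependent ℝ f) :
    Function.Injective (linearCombinationL f) := by
  refine (injective_iff_map_eq_zero _).2 fun c hc => PiLp.ext fun i => ?_
  exact Fintype.linearIndependent_iff.1 hf c (linearCombinationL_apply f c ▸ hc) i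

theorem range_linearCombinationL (f : ι → V) :
    (linearCombinationL f).range = Submodule.span ℝ (range f) := by
  ext v
  rw [Submodule.mem_span_range_iff_exists_fun]
  refine ⟨fun ⟨c, hc⟩ => ⟨c, ?_⟩, fun ⟨c, hc⟩ => ⟨WithLp.toLp 2 c, ?_⟩⟩
  · rw [← hc, ← linearCombinationL_apply]; rfl
  · rw [← hc]; exact linearCombinationL_apply f _

theorem contMDiffAt_linearCombinationL {f : X → ι → V}
    (hf : ∀ i, ContMDiffAt I 𝓘(ℝ, V) n (fun x => f x i) x₀) :
    ContMDiffAt I 𝓘(ℝ, EuclideanSpace ℝ ι →L[ℝ] V) n (fun x => linearCombinationL (f x)) x₀ :=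
  ContMDiffAt.sum fun i _ => (ContinuousLinearMap.smulRightL ℝ (EuclideanSpace ℝ ι) V
    (EuclideanSpace.proj i)).contDiff.contMDiff.contMDiffAt.comp x₀ (hf i)

end LinearCombination

noncomputable section Frame

variable {m : ℕ} {M : Type*} [TopologicalSpace M] [ChartedSpace (EuclideanSpace ℝ (Fin m)) M]
  {p : ℕ} {W : M → Type*} [∀ x, AddCommGroup (W x)] [∀ x, Module ℝ (W x)]
  [∀ x, TopologicalSpace (W x)] [TopologicalSpace (TotalSpace (EuclideanSpace ℝ (Fin p)) W)]
  [FiberBundle (EuclideanSpace ℝ (Fin p)) W] [VectorBundle ℝ (EuclideanSpace ℝ (Fin p)) W]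
  {U : Opens M}

theorem span_fiber_eq_top_of_linearIndependent {x : M} {v : Fin p → W x}
    (hv : LinearIndependent ℝ v) : Submodule.span ℝ (range v) = ⊤ := by
  let e : W x ≃ₗ[ℝ] EuclideanSpace ℝ (Fin p) :=
    ((trivializationAt (EuclideanSpace ℝ (Fin p)) W x).continuousLinearEquivAt ℝ x
      (mem_baseSet_trivializationAt _ W x)).toLinearEquiv
  have : FiniteDimensional ℝ (W x) := e.symm.finiteDimensional
  exact hv.span_eq_top_of_card_eq_finrank' (by rw [e.finrank_eq, finrank_euclideanSpace])

theorem sum_smul_apply {ι : Type*} [Fintype ι] (f : ι → SmoothFun m U)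
    (s : ι → localSections m p W U) (x : U) :
    (∑ i, f i • s i).1 x = ∑ i, f i x • (s i).1 x := by
  rw [AddSubgroup.val_finsetSum, Finset.sum_apply]
  rfl

theorem sum_wedge_apply {ι : Type*} [Fintype ι] (ψ θ : ι → OneForm m p W U)
    (S T : localSections m p W U) :
    (∑ i, wedge (ψ i) (θ i)) S T = ∑ i, (ψ i S * θ i T - ψ i T * θ i S) := by
  simp only [Finset.sum_apply, wedge]

variable (t : Fin p → localSections m p W U)
  (ht : ∀ x : U, LinearIndependent ℝ fun a => (t a).1 x)

/-- The linear isomorphism from `ℝᵖ` to the fibre over `x` given by the values at `x` of a frame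
`t` over `U`. -/
def frameEquiv (x : U) : EuclideanSpace ℝ (Fin p) ≃ₗ[ℝ] W x :=
  (WithLp.linearEquiv 2 ℝ (Fin p → ℝ)).trans
    (Module.Basis.mk (ht x)
      (span_fiber_eq_top_of_linearIndependent (ht x)).ge).equivFun.symm

theorem frameEquiv_apply (x : U) (c : EuclideanSpace ℝ (Fin p)) :
    frameEquiv t ht x c = ∑ a, c a • (t a).1 x := by
  simp [frameEquiv, Module.Basis.equivFun_symm_apply]

theorem contMDiffAt_frameEquiv_iff {x₀ : U} {c : U → EuclideanSpace ℝ (Fin p)} :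
    ContMDiffAt (𝓡 m) ((𝓡 m).prod 𝓘(ℝ, EuclideanSpace ℝ (Fin p))) ∞
      (fun x : U => (⟨x, frameEquiv t ht x (c x)⟩ : TotalSpace (EuclideanSpace ℝ (Fin p)) W)) x₀ ↔
    ContMDiffAt (𝓡 m) 𝓘(ℝ, EuclideanSpace ℝ (Fin p)) ∞ c x₀ := by
  let triv := trivializationAt (EuclideanSpace ℝ (Fin p)) W (x₀ : M)
  let A (x : U) : EuclideanSpace ℝ (Fin p) →L[ℝ] EuclideanSpace ℝ (Fin p) :=
    linearCombinationL fun a => (triv ⟨x, (t a).1 x⟩).2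
  have hA : ContMDiffAt (𝓡 m) 𝓘(ℝ, EuclideanSpace ℝ (Fin p) →L[ℝ] EuclideanSpace ℝ (Fin p)) ∞
      A x₀ :=
    contMDiffAt_linearCombinationL fun a => (isSmoothSection_iff m p W U _).1 (t a).2 x₀
  have hAc (c : U → EuclideanSpace ℝ (Fin p)) :
      ∀ᶠ x : U in 𝓝 x₀, (triv ⟨x, frameEquiv t ht x (c x)⟩).2 = A x (c x) := by
    filter_upwards [eventually_mem_baseSet p W U x₀] with x hx
    let L := triv.continuousLinearEquivAt ℝ (x : M) hx
    change L (frameEquiv t ht x (c x)) = linearCombinationL (fun a => L ((t a).1 x)) (c x)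
    rw [linearCombinationL_apply, frameEquiv_apply, map_sum]
    simp only [map_smul]
  have hA_inv : (A x₀).IsInvertible := by
    have h_indep : LinearIndependent ℝ fun a => (triv ⟨x₀, (t a).1 x₀⟩).2 :=
      (ht x₀).map' (triv.continuousLinearEquivAt ℝ (x₀ : M)
        (mem_baseSet_trivializationAt _ W _)).toLinearEquiv.toLinearMap (LinearEquiv.ker _)
    exact ⟨(LinearEquiv.ofInjectiveEndo (A x₀).toLinearMap
      (linearCombinationL_injective h_indep)).toContinuousLinearEquiv, rfl⟩
  rw [contMDiffAt_totalSpace, and_iff_right (contMDiff_subtype_val x₀)]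
  refine (Filter.EventuallyEq.contMDiffAt_iff (hAc c)).trans
    ⟨contMDiffAt_of_clm_apply hA hA_inv, hA.clm_apply⟩

theorem contMDiff_frameEquiv_symm (S : localSections m p W U) :
    ContMDiff (𝓡 m) 𝓘(ℝ, EuclideanSpace ℝ (Fin p)) ∞
      fun x => (frameEquiv t ht x).symm (S.1 x) := fun x₀ =>
  (contMDiffAt_frameEquiv_iff t ht).1 <| by
    simpa only [LinearEquiv.apply_symm_apply] using S.2 x₀

/-- The coordinate functions of a section over `U` in the frame `t`. -/
def frameCoord (S : localSections m p W U) (a : Fin p) : SmoothFun m U :=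
  ⟨fun x => (frameEquiv t ht x).symm (S.1 x) a,
    (EuclideanSpace.proj (𝕜 := ℝ) a).contDiff.contMDiff.comp (contMDiff_frameEquiv_symm t ht S)⟩

theorem sum_frameCoord_smul (S : localSections m p W U) : ∑ a, frameCoord t ht S a • t a = S :=
  Subtype.ext <| funext fun x =>
    calc _ = ∑ a, frameCoord t ht S a x • (t a).1 x := sum_smul_apply _ t x
      _ = frameEquiv t ht x ((frameEquiv t ht x).symm (S.1 x)) :=
        (frameEquiv_apply t ht x ((frameEquiv t ht x).symm (S.1 x))).symm
      _ = S.1 x := LinearEquiv.apply_symm_apply _ _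

/-- A frame over `U` as a basis of the module of sections over `U`. -/
def frameBasis : Module.Basis (Fin p) (SmoothFun m U) (localSections m p W U) :=
  .mk (v := t)
    (Fintype.linearIndependent_iff.2 fun f hf a => ContMDiffMap.ext fun x =>
      Fintype.linearIndependent_iff.1 (ht x) (fun a => f a x)
        ((sum_smul_apply f t x).symm.trans (congrFun (congrArg Subtype.val hf) x)) a)
    fun S _ => (Submodule.mem_span_range_iff_exists_fun _).2 ⟨_, sum_frameCoord_smul t ht S⟩

/-- The map on sections over `U` induced by a family of linear endomorphisms of the fibres which
preserves smoothness. -/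
def sectionsMap (Q : ∀ x : U, W x →ₗ[ℝ] W x)
    (hQ : ∀ S : localSections m p W U, IsSmoothSection m p W U fun x => Q x (S.1 x)) :
    localSections m p W U →ₗ[SmoothFun m U] localSections m p W U where
  toFun S := ⟨fun x => Q x (S.1 x), hQ S⟩
  map_add' S T := Subtype.ext <| funext fun x => map_add (Q x) (S.1 x) (T.1 x)
  map_smul' f S := Subtype.ext <| funext fun x => map_smul (Q x) (f x) (S.1 x)

namespace VectorSubbundle

variable {r : ℕ} (E : VectorSubbundle m p W r)

theorem exists_frame_nhds (x₀ : M) :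
    ∃ s : Fin r → ∀ x, W x,
      (∀ i, ContMDiffAt (𝓡 m) ((𝓡 m).prod 𝓘(ℝ, EuclideanSpace ℝ (Fin p))) ∞
        (fun x => (⟨x, s i x⟩ : TotalSpace (EuclideanSpace ℝ (Fin p)) W)) x₀) ∧
      ∀ᶠ x in 𝓝 x₀, LinearIndependent ℝ (fun i => s i x) ∧
        Submodule.span ℝ (range fun i => s i x) = E.fiber x := by
  classical
  obtain ⟨V, hV, s, hs⟩ := E.exists_frame x₀
  let s' (i : Fin r) (x : M) : W x := if hx : x ∈ V then (s i).1 ⟨x, hx⟩ else 0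
  have hs' (i : Fin r) (x : V) : s' i x = (s i).1 x := dif_pos x.2
  refine ⟨s', fun i => ?_, ?_⟩
  · refine (contMDiffAt_subtype_iff (x := (⟨x₀, hV⟩ : V))).1 ?_
    simpa only [hs'] using (s i).2 ⟨x₀, hV⟩
  · filter_upwards [V.isOpen.mem_nhds hV] with x hx
    simpa only [← hs'] using hs ⟨x, hx⟩

/-- The fibre of `E` over `x` as a subspace of `ℝᵖ`, in the coordinates given by a frame. -/
def coordFiber (x : U) : Submodule ℝ (EuclideanSpace ℝ (Fin p)) :=
  (E.fiber x).comap (frameEquiv t ht x).toLinearMap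

theorem contMDiffAt_starProjection_coordFiber {x₀ : U} {c : U → EuclideanSpace ℝ (Fin p)}
    (hc : ContMDiffAt (𝓡 m) 𝓘(ℝ, EuclideanSpace ℝ (Fin p)) ∞ c x₀) :
    ContMDiffAt (𝓡 m) 𝓘(ℝ, EuclideanSpace ℝ (Fin p)) ∞
      (fun x => (E.coordFiber t ht x).starProjection (c x)) x₀ := by
  obtain ⟨s, hs_smooth, hs⟩ := E.exists_frame_nhds (x₀ : M)
  let σ (x : U) (i : Fin r) : EuclideanSpace ℝ (Fin p) := (frameEquiv t ht x).symm (s i x)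
  have hσ_smooth (i : Fin r) :
      ContMDiffAt (𝓡 m) 𝓘(ℝ, EuclideanSpace ℝ (Fin p)) ∞ (fun x => σ x i) x₀ := by
    refine (contMDiffAt_frameEquiv_iff t ht).1 ?_
    simpa only [σ, LinearEquiv.apply_symm_apply] using contMDiffAt_subtype_iff.2 (hs_smooth i)
  have hσ_indep : LinearIndependent ℝ (σ x₀) :=
    hs.self_of_nhds.1.map' (frameEquiv t ht x₀).symm.toLinearMap (LinearEquiv.ker _)
  refine (contMDiffAt_starProjection_range (contMDiffAt_linearCombinationL hσ_smooth)
    (linearCombinationL_injective hσ_indep) hc).congr_of_eventuallyEq ?_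
  filter_upwards [continuous_subtype_val.continuousAt.eventually hs] with x hx
  have h_coord : E.coordFiber t ht x = (linearCombinationL (σ x)).range := by
    rw [range_linearCombinationL, coordFiber, ← hx.2, Submodule.comap_equiv_eq_map_symm,
      Submodule.map_span, ← range_comp]
    rfl
  rw [h_coord]

theorem exists_isProj_sections (hU : IsBundleChartDomain m p W U) :
    ∃ Q : localSections m p W U →ₗ[SmoothFun m U] localSections m p W U,
      LinearMap.IsProj (E.sections U) Q := by
  obtain ⟨t, ht⟩ := hU
  let Q (x : U) : W x →ₗ[ℝ] W x := (frameEquiv t ht x).toLinearMap ∘ₗ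
    (E.coordFiber t ht x).starProjection.toLinearMap ∘ₗ (frameEquiv t ht x).symm.toLinearMap
  have hQ (S : localSections m p W U) : IsSmoothSection m p W U fun x => Q x (S.1 x) := fun x₀ =>
    (contMDiffAt_frameEquiv_iff t ht).2
      (E.contMDiffAt_starProjection_coordFiber t ht (contMDiff_frameEquiv_symm t ht S x₀))
  refine ⟨sectionsMap Q hQ, fun S x => ?_, fun S hS => Subtype.ext (funext fun x => ?_)⟩
  · exact (E.coordFiber t ht x).starProjection_apply_mem _
  · have h_mem : (frameEquiv t ht x).symm (S.1 x) ∈ E.coordFiber t ht x := by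
      simpa [coordFiber] using hS x
    calc _ = frameEquiv t ht x ((frameEquiv t ht x).symm (S.1 x)) :=
          congrArg _ (Submodule.starProjection_eq_self_iff.2 h_mem)
      _ = S.1 x := LinearEquiv.apply_symm_apply _ _

theorem isReflexive_quotient_sections (hU : IsBundleChartDomain m p W U) :
    Module.IsReflexive (SmoothFun m U) (localSections m p W U ⧸ E.sections U) := by
  obtain ⟨Q, hQ⟩ := E.exists_isProj_sections hU
  obtain ⟨t, ht⟩ := hU
  have : Module.Free (SmoothFun m U) (localSections m p W U) := .of_basis (frameBasis t ht)
  have : Module.Finite (SmoothFun m U) (localSections m p W U) := .of_basis (frameBasis t ht)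
  exact isReflexive_quotient_of_isProj hQ

end VectorSubbundle

end Frame

theorem extend_eventuallyEq {M : Type*} [TopologicalSpace M] {U : Opens M} {f : U → ℝ} {g : M → ℝ}
    {x : U} (hfg : ∀ᶠ z in 𝓝 x, f z = g z) :
    Function.extend Subtype.val f 0 =ᶠ[𝓝 (x : M)] g := by
  rw [← U.isOpen.isOpenEmbedding_subtypeVal.map_nhds_eq x]
  exact hfg.mono fun z hz => (Subtype.val_injective.extend_apply f 0 z).trans hz

theorem exists_contMDiffMap_eventuallyEq {m : ℕ} {M : Type*} [TopologicalSpace M]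
    [ChartedSpace (EuclideanSpace ℝ (Fin m)) M] [IsManifold (𝓡 m) ∞ M] [T2Space M] {U : Opens M}
    (f : SmoothFun m U) (x : U) :
    ∃ g : C^∞⟮𝓡 m, M; 𝓘(ℝ, ℝ), ℝ⟯, ∀ᶠ z in 𝓝 x, f z = g z := by
  obtain ⟨g, hg⟩ := exists_smooth_germ f x
  refine ⟨g, ?_⟩
  filter_upwards [continuous_subtype_val.continuousAt.eventually hg] with z hz
  rwa [Subtype.val_injective.extend_apply] at hz

noncomputable section Transport

variable {m n : ℕ} {M N : Type*}
  [TopologicalSpace M] [ChartedSpace (EuclideanSpace ℝ (Fin m)) M]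
  [TopologicalSpace N] [ChartedSpace (EuclideanSpace ℝ (Fin n)) N]

/-- The transport to `N` of a smooth function on `M`, along a diffeomorphism from `M` to `N`. -/
def pushforwardFun (h : M ≃ₘ⟮𝓡 m, 𝓡 n⟯ N) (g : C^∞⟮𝓡 m, M; 𝓘(ℝ, ℝ), ℝ⟯) :
    C^∞⟮𝓡 n, N; 𝓘(ℝ, ℝ), ℝ⟯ :=
  ⟨g ∘ h.symm, g.contMDiff.comp h.symm.contMDiff⟩

theorem pushforwardFun_apply (h : M ≃ₘ⟮𝓡 m, 𝓡 n⟯ N) (g : C^∞⟮𝓡 m, M; 𝓘(ℝ, ℝ), ℝ⟯) (x : M) :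
    pushforwardFun h g (h x) = g x :=
  congrArg g (h.symm_apply_apply x)

end Transport

noncomputable section Pullback

variable {m n : ℕ} {M N : Type*}
  [TopologicalSpace M] [ChartedSpace (EuclideanSpace ℝ (Fin m)) M]
  [TopologicalSpace N] [ChartedSpace (EuclideanSpace ℝ (Fin n)) N]
  {p : ℕ} {F : N → Type*} [∀ y, AddCommGroup (F y)] [∀ y, Module ℝ (F y)]
  [∀ y, TopologicalSpace (F y)] [TopologicalSpace (TotalSpace (EuclideanSpace ℝ (Fin p)) F)]
  [FiberBundle (EuclideanSpace ℝ (Fin p)) F] [VectorBundle ℝ (EuclideanSpace ℝ (Fin p)) F]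
  {h : M ≃ₘ⟮𝓡 m, 𝓡 n⟯ N} {η : N ≃ₘ⟮𝓡 n, 𝓡 m⟯ M} {U : Opens M}

theorem induces_pullbackSection (u : GlobalSection (n := n) p F) (x : U) :
    Induces u (pullbackSection h U u) x :=
  .of_forall fun _ => rfl

theorem Induces.add {u v : GlobalSection (n := n) p F} {S T : localSections m p (h *ᵖ F) U} {x : U}
    (hu : Induces u S x) (hv : Induces v T x) : Induces (u + v) (S + T) x := by
  filter_upwards [hu, hv] with z hSz hTz
  exact congrArg₂ (fun a b : F (h z) => a + b) hSz hTz

theorem Induces.mulSection {u : GlobalSection (n := n) p F} {S : localSections m p (h *ᵖ F) U}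
    {x : U} (hu : Induces u S x) {f : SmoothFun m U} {g : C^∞⟮𝓡 m, M; 𝓘(ℝ, ℝ), ℝ⟯}
    (hfg : ∀ᶠ z in 𝓝 x, f z = g z) : Induces (mulSection (pushforwardFun h g) u) (f • S) x := by
  filter_upwards [hu, hfg] with z hSz hfz
  calc f z • S.1 z = g z • (pullbackSection h U u).1 z := by rw [hSz, hfz]
    _ = (pullbackSection h U (GenLie.mulSection (pushforwardFun h g) u)).1 z :=
      congrArg (fun a : ℝ => (a • u (h z) : F (h z))) (pushforwardFun_apply h g z).symm

namespace GeneralizedLieAlgebroid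

variable [IsManifold (𝓡 m) ∞ M] (A : GeneralizedLieAlgebroid p F h η)

theorem pullbackAnchorDeriv_add_fun (u : GlobalSection (n := n) p F)
    (f g : C^∞⟮𝓡 m, M; 𝓘(ℝ, ℝ), ℝ⟯) (x : M) :
    A.pullbackAnchorDeriv u (f + g) x =
      A.pullbackAnchorDeriv u f x + A.pullbackAnchorDeriv u g x :=
  congrArg (fun L : EuclideanSpace ℝ (Fin m) →L[ℝ] ℝ => L (A.ρ (η.symm x) (u (η.symm x))))
    (mfderiv_add (f.contMDiff.mdifferentiable (by simp) (η (η.symm x)))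
      (g.contMDiff.mdifferentiable (by simp) (η (η.symm x))))

theorem pullbackAnchorDeriv_mul_fun (u : GlobalSection (n := n) p F)
    (f g : C^∞⟮𝓡 m, M; 𝓘(ℝ, ℝ), ℝ⟯) (x : M) :
    A.pullbackAnchorDeriv u (f * g) x =
      f x * A.pullbackAnchorDeriv u g x + g x * A.pullbackAnchorDeriv u f x := by
  have product_rule := ((f.contMDiff.mdifferentiable (by simp) (η (η.symm x))).hasMFDerivAt.mul
    (g.contMDiff.mdifferentiable (by simp) (η (η.symm x))).hasMFDerivAt).mfderiv
  calc A.pullbackAnchorDeriv u (f * g) x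
      = f (η (η.symm x)) * A.pullbackAnchorDeriv u g x
        + g (η (η.symm x)) * A.pullbackAnchorDeriv u f x :=
        congrArg (fun L : EuclideanSpace ℝ (Fin m) →L[ℝ] ℝ => L (A.ρ (η.symm x) (u (η.symm x))))
          product_rule
    _ = _ := by rw [η.apply_symm_apply]

theorem pullbackAnchorDeriv_add (u v : GlobalSection (n := n) p F) (f : M → ℝ) (x : M) :
    A.pullbackAnchorDeriv (u + v) f x =
      A.pullbackAnchorDeriv u f x + A.pullbackAnchorDeriv v f x :=
  (congrArg (mfderiv (𝓡 m) 𝓘(ℝ, ℝ) f (η (η.symm x)))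
    (map_add (A.ρ (η.symm x)) (u (η.symm x)) (v (η.symm x)))).trans (map_add _ _ _)

theorem pullbackAnchorDeriv_mulSection (u : GlobalSection (n := n) p F)
    (g : C^∞⟮𝓡 n, N; 𝓘(ℝ, ℝ), ℝ⟯) (f : M → ℝ) (x : M) :
    A.pullbackAnchorDeriv (mulSection g u) f x =
      g (η.symm x) * A.pullbackAnchorDeriv u f x :=
  (congrArg (mfderiv (𝓡 m) 𝓘(ℝ, ℝ) f (η (η.symm x)))
    (map_smul (A.ρ (η.symm x)) (g (η.symm x)) (u (η.symm x)))).trans (map_smul _ _ _)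

variable [T2Space M] [IsManifold (𝓡 n) ∞ N]
  [ContMDiffVectorBundle ∞ (EuclideanSpace ℝ (Fin p)) F (𝓡 n)]

/-- The anchor at `x` is determined by the germ of `u` at `h x`, and also by the value of `u` at
`η⁻¹ x`. If these two points differ, then `u` can be made zero at the second one without changing
its germ at the first one. -/
theorem pullbackAnchorDeriv_eq_zero_of_ne (u : GlobalSection (n := n) p F)
    (f : C^∞⟮𝓡 m, M; 𝓘(ℝ, ℝ), ℝ⟯) {x : M} (hx : η.symm x ≠ h x) :
    A.pullbackAnchorDeriv u f x = 0 := by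
  have : T2Space N := t2Space h
  obtain ⟨φ, φ_eq_one, tsupport_φ⟩ := exists_bump (n := n) (h x) {η.symm x}ᶜ
    (isOpen_compl_singleton.mem_nhds (by simpa using hx.symm))
  have φ_eq_zero : φ (η.symm x) = 0 :=
    image_eq_zero_of_notMem_tsupport fun hmem => tsupport_φ hmem rfl
  have u_eq : ∀ᶠ y in 𝓝 (h x), u y = mulSection φ u y := by
    filter_upwards [φ_eq_one] with y hy
    exact ((congrArg (fun a : ℝ => a • u y) hy).trans (one_smul ℝ (u y))).symm
  rw [A.pullbackAnchorDeriv_congr u_eq .rfl f.contMDiff, pullbackAnchorDeriv_mulSection,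
    φ_eq_zero, zero_mul]

theorem pullbackAnchorDeriv_mulSection_of_smooth (u : GlobalSection (n := n) p F)
    (g : C^∞⟮𝓡 n, N; 𝓘(ℝ, ℝ), ℝ⟯) (f : C^∞⟮𝓡 m, M; 𝓘(ℝ, ℝ), ℝ⟯) (x : M) :
    A.pullbackAnchorDeriv (mulSection g u) f x = g (h x) * A.pullbackAnchorDeriv u f x := by
  by_cases hx : η.symm x = h x
  · rw [pullbackAnchorDeriv_mulSection, hx]
  · simp only [A.pullbackAnchorDeriv_eq_zero_of_ne _ f hx, mul_zero]

theorem localAnchor_apply_of_eventuallyEq {u : GlobalSection (n := n) p F}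
    {S : localSections m p (h *ᵖ F) U} {f : SmoothFun m U} {g : C^∞⟮𝓡 m, M; 𝓘(ℝ, ℝ), ℝ⟯} {x : U}
    (hu : Induces u S x) (hfg : ∀ᶠ z in 𝓝 x, f z = g z) :
    A.localAnchor U S f x = A.pullbackAnchorDeriv u g x :=
  A.localAnchor_apply hu g.contMDiff (extend_eventuallyEq hfg)

theorem localAnchor_add_fun (S : localSections m p (h *ᵖ F) U) (f g : SmoothFun m U) :
    A.localAnchor U S (f + g) = A.localAnchor U S f + A.localAnchor U S g := by
  ext x
  obtain ⟨u, hu⟩ := exists_induces S x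
  obtain ⟨f', hf⟩ := exists_contMDiffMap_eventuallyEq f x
  obtain ⟨g', hg⟩ := exists_contMDiffMap_eventuallyEq g x
  have hfg : ∀ᶠ z in 𝓝 x, (f + g) z = (f' + g') z := by
    filter_upwards [hf, hg] with z hfz hgz using congrArg₂ (· + ·) hfz hgz
  change _ = A.localAnchor U S f x + A.localAnchor U S g x
  rw [A.localAnchor_apply_of_eventuallyEq hu hf, A.localAnchor_apply_of_eventuallyEq hu hg,
    A.localAnchor_apply_of_eventuallyEq hu hfg]
  exact A.pullbackAnchorDeriv_add_fun u f' g' x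

theorem localAnchor_mul_fun (S : localSections m p (h *ᵖ F) U) (f g : SmoothFun m U) :
    A.localAnchor U S (f * g) = f * A.localAnchor U S g + g * A.localAnchor U S f := by
  ext x
  obtain ⟨u, hu⟩ := exists_induces S x
  obtain ⟨f', hf⟩ := exists_contMDiffMap_eventuallyEq f x
  obtain ⟨g', hg⟩ := exists_contMDiffMap_eventuallyEq g x
  have hfg : ∀ᶠ z in 𝓝 x, (f * g) z = (f' * g') z := by
    filter_upwards [hf, hg] with z hfz hgz using congrArg₂ (· * ·) hfz hgz
  change _ = f x * A.localAnchor U S g x + g x * A.localAnchor U S f x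
  rw [A.localAnchor_apply_of_eventuallyEq hu hf, A.localAnchor_apply_of_eventuallyEq hu hg,
    A.localAnchor_apply_of_eventuallyEq hu hfg, hf.self_of_nhds, hg.self_of_nhds]
  exact A.pullbackAnchorDeriv_mul_fun u f' g' x

theorem localAnchor_add (S T : localSections m p (h *ᵖ F) U) (f : SmoothFun m U) :
    A.localAnchor U (S + T) f = A.localAnchor U S f + A.localAnchor U T f := by
  ext x
  obtain ⟨u, hu⟩ := exists_induces S x
  obtain ⟨v, hv⟩ := exists_induces T x
  obtain ⟨g, hfg⟩ := exists_contMDiffMap_eventuallyEq f x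
  change _ = A.localAnchor U S f x + A.localAnchor U T f x
  rw [A.localAnchor_apply_of_eventuallyEq hu hfg, A.localAnchor_apply_of_eventuallyEq hv hfg,
    A.localAnchor_apply_of_eventuallyEq (hu.add hv) hfg]
  exact A.pullbackAnchorDeriv_add u v g x

theorem localAnchor_smul (a : SmoothFun m U) (S : localSections m p (h *ᵖ F) U)
    (f : SmoothFun m U) : A.localAnchor U (a • S) f = a * A.localAnchor U S f := by
  ext x
  obtain ⟨u, hu⟩ := exists_induces S x
  obtain ⟨a', ha⟩ := exists_contMDiffMap_eventuallyEq a x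
  obtain ⟨g, hfg⟩ := exists_contMDiffMap_eventuallyEq f x
  change _ = a x * A.localAnchor U S f x
  rw [A.localAnchor_apply_of_eventuallyEq hu hfg,
    A.localAnchor_apply_of_eventuallyEq (hu.mulSection ha) hfg,
    pullbackAnchorDeriv_mulSection_of_smooth, pushforwardFun_apply, ha.self_of_nhds]

theorem localBracket_skew (S T : localSections m p (h *ᵖ F) U) :
    A.localBracket U S T = -A.localBracket U T S := by
  refine Subtype.ext (funext fun x => ?_)
  obtain ⟨u, hu⟩ := exists_induces S x
  obtain ⟨v, hv⟩ := exists_induces T x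
  change _ = -(A.localBracket U T S).1 x
  rw [A.localBracket_apply hu hv, A.localBracket_apply hv hu, A.bracket_skew]
  rfl

theorem localBracket_add (S T T' : localSections m p (h *ᵖ F) U) :
    A.localBracket U S (T + T') = A.localBracket U S T + A.localBracket U S T' := by
  refine Subtype.ext (funext fun x => ?_)
  obtain ⟨u, hu⟩ := exists_induces S x
  obtain ⟨v, hv⟩ := exists_induces T x
  obtain ⟨v', hv'⟩ := exists_induces T' x
  change _ = (A.localBracket U S T).1 x + (A.localBracket U S T').1 x
  rw [A.localBracket_apply hu hv, A.localBracket_apply hu hv',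
    A.localBracket_apply hu (hv.add hv'), A.bracket_add]
  rfl

theorem localBracket_smul (S : localSections m p (h *ᵖ F) U) (a : SmoothFun m U)
    (T : localSections m p (h *ᵖ F) U) :
    A.localBracket U S (a • T) = a • A.localBracket U S T + A.localAnchor U S a • T := by
  refine Subtype.ext (funext fun x => ?_)
  obtain ⟨u, hu⟩ := exists_induces S x
  obtain ⟨v, hv⟩ := exists_induces T x
  obtain ⟨a', ha⟩ := exists_contMDiffMap_eventuallyEq a x
  change _ = a x • (A.localBracket U S T).1 x + A.localAnchor U S a x • T.1 x
  rw [A.localBracket_apply hu hv, A.localBracket_apply hu (hv.mulSection ha),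
    A.localAnchor_apply_of_eventuallyEq hu ha, hv.self_of_nhds, ha.self_of_nhds]
  refine (A.leibniz u v (pushforwardFun h a') (h x)).trans ?_
  rw [A.anchorDeriv_eq]
  simp only [pushforwardFun_apply]
  rfl

theorem extDeriv_skew (θ : OneForm m p (h *ᵖ F) U) (S T : localSections m p (h *ᵖ F) U) :
    A.extDeriv U θ S T = -A.extDeriv U θ T S := by
  unfold extDeriv
  rw [A.localBracket_skew S T, map_neg]
  ring

theorem extDeriv_add (θ : OneForm m p (h *ᵖ F) U) (S T T' : localSections m p (h *ᵖ F) U) :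
    A.extDeriv U θ S (T + T') = A.extDeriv U θ S T + A.extDeriv U θ S T' := by
  unfold extDeriv
  rw [map_add, A.localBracket_add, map_add, A.localAnchor_add_fun, A.localAnchor_add]
  ring

theorem extDeriv_smul (θ : OneForm m p (h *ᵖ F) U) (S : localSections m p (h *ᵖ F) U)
    (a : SmoothFun m U) (T : localSections m p (h *ᵖ F) U) :
    A.extDeriv U θ S (a • T) = a * A.extDeriv U θ S T := by
  unfold extDeriv
  simp only [map_smul, map_add, localBracket_smul, localAnchor_smul, localAnchor_mul_fun,
    smul_eq_mul]
  ring

/-- The differential of a `1`-form over `U`, as a bilinear form over the smooth functions on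
`U`. -/
def extDerivBilin (θ : OneForm m p (h *ᵖ F) U) :
    localSections m p (h *ᵖ F) U →ₗ[SmoothFun m U] OneForm m p (h *ᵖ F) U :=
  .mk₂ _ (A.extDeriv U θ)
    (fun S S' T => by
      rw [A.extDeriv_skew, A.extDeriv_add, neg_add, ← A.extDeriv_skew, ← A.extDeriv_skew])
    (fun a S T => by rw [A.extDeriv_skew, A.extDeriv_smul, ← mul_neg, ← A.extDeriv_skew]; rfl)
    (A.extDeriv_add θ) (fun a S T => A.extDeriv_smul θ S a T)

end GeneralizedLieAlgebroid

variable {r : ℕ}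

/-- The global sections `u` of `F` such that `u ∘ h` takes values in the subbundle `E` of `h*F`:
they represent the sections of `E`, globally by `u ↦ u ∘ h` and locally by `Induces`. -/
def VectorSubbundle.globalSections (E : VectorSubbundle m p (h *ᵖ F) r) :
    Set (GlobalSection (n := n) p F) :=
  {u | ∀ x, u (h x) ∈ E.fiber x}

variable [IsManifold (𝓡 m) ∞ M] [T2Space M] [IsManifold (𝓡 n) ∞ N]
  [ContMDiffVectorBundle ∞ (EuclideanSpace ℝ (Fin p)) F (𝓡 n)]

theorem VectorSubbundle.exists_mem_globalSections_induces
    {E : VectorSubbundle m p (h *ᵖ F) r} {S : localSections m p (h *ᵖ F) U}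
    (hS : S ∈ E.sections U) (x : U) :
    ∃ u ∈ E.globalSections, Induces u S x := by
  obtain ⟨u, hu⟩ := exists_induces S x
  have u_mem : ∀ᶠ z : M in 𝓝 (x : M), u (h z) ∈ E.fiber z := by
    rw [← U.isOpen.isOpenEmbedding_subtypeVal.map_nhds_eq x, Filter.eventually_map]
    filter_upwards [hu] with z hz
    have h_mem := hS z
    rwa [hz] at h_mem
  obtain ⟨φ, φ_eq_one, tsupport_φ⟩ := exists_bump (n := m) (x : M) _ u_mem
  have φ_induces : Induces (mulSection (pushforwardFun h φ) u) ((1 : SmoothFun m U) • S) x :=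
    hu.mulSection (continuous_subtype_val.continuousAt.eventually (φ_eq_one.mono fun _ => Eq.symm))
  refine ⟨_, fun z => ?_, one_smul (SmoothFun m U) S ▸ φ_induces⟩
  change (pushforwardFun h φ (h z) • u (h z) : F (h z)) ∈ E.fiber z
  rw [pushforwardFun_apply]
  by_cases hz : z ∈ tsupport φ
  · exact (E.fiber z).smul_mem _ (tsupport_φ hz)
  · rw [image_eq_zero_of_notMem_tsupport hz]
    exact (zero_smul ℝ (u (h z))).symm ▸ (E.fiber z).zero_mem

namespace GeneralizedLieAlgebroid

variable (A : GeneralizedLieAlgebroid p F h η) (E : VectorSubbundle m p (h *ᵖ F) r)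

/-- The subbundle `E` of `h*F` is involutive over `U`: the bracket of the pull-back Lie algebroid
preserves the sections of `E` over `U`. For `U = ⊤` this is `Involutive`. -/
def InvolutiveOn (U : Opens M) : Prop :=
  ∀ S ∈ E.sections U, ∀ T ∈ E.sections U, A.localBracket U S T ∈ E.sections U

theorem involutiveOn_iff :
    A.InvolutiveOn E U ↔ ∀ u ∈ E.globalSections, ∀ v ∈ E.globalSections,
      ∀ x ∈ U, A.bracket u v (h x) ∈ E.fiber x := by
  constructor
  · intro hE u hu v hv x hx
    have h_mem := hE (pullbackSection h U u) (fun z => hu z) (pullbackSection h U v)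
      (fun z => hv z) ⟨x, hx⟩
    rwa [A.localBracket_apply (induces_pullbackSection u _) (induces_pullbackSection v _)] at h_mem
  · intro hE S hS T hT x
    obtain ⟨u, hu, u_induces⟩ := VectorSubbundle.exists_mem_globalSections_induces hS x
    obtain ⟨v, hv, v_induces⟩ := VectorSubbundle.exists_mem_globalSections_induces hT x
    rw [A.localBracket_apply u_induces v_induces]
    exact hE u hu v hv x x.2

theorem involutive_iff_forall_involutiveOn {κ : Type*} {U : κ → Opens M}
    (hU : ⨆ i, U i = ⊤) : A.Involutive E ↔ ∀ i, A.InvolutiveOn E (U i) := by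
  change A.InvolutiveOn E ⊤ ↔ _
  simp only [involutiveOn_iff, ← hU, Opens.mem_iSup]
  grind

theorem localAnchor_zero (S : localSections m p (h *ᵖ F) U) : A.localAnchor U S 0 = 0 := by
  simpa using A.localAnchor_add_fun S 0 0

theorem extDeriv_of_apply_eq_zero {θ : OneForm m p (h *ᵖ F) U}
    {S T : localSections m p (h *ᵖ F) U} (hS : θ S = 0) (hT : θ T = 0) :
    A.extDeriv U θ S T = -θ (A.localBracket U S T) := by
  simp only [extDeriv, hS, hT, localAnchor_zero, sub_zero, zero_sub]

variable {ι : Type*} [Fintype ι]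

theorem exists_extDeriv_eq_sum_wedge [DecidableEq ι] {θ : ι → OneForm m p (h *ᵖ F) U}
    {e : ι → localSections m p (h *ᵖ F) U} (he : ∀ α β, θ α (e β) = if α = β then 1 else 0)
    {α : ι}
    (hα : ∀ S T, (∀ β, θ β S = 0) → (∀ β, θ β T = 0) → θ α (A.localBracket U S T) = 0) :
    ∃ Ω : ι → OneForm m p (h *ᵖ F) U, A.extDeriv U (θ α) = ∑ β, wedge (Ω β) (θ β) := by
  let : Invertible (2 : SmoothFun m U) :=
    (Invertible.map (algebraMap ℝ (SmoothFun m U)) 2).copy 2 (map_ofNat _ 2).symm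
  have vanishes (S T : localSections m p (h *ᵖ F) U) (hS : ∀ β, θ β S = 0)
      (hT : ∀ β, θ β T = 0) : A.extDerivBilin (θ α) S T = 0 :=
    (A.extDeriv_of_apply_eq_zero (hS α) (hT α)).trans (neg_eq_zero.2 (hα S T hS hT))
  obtain ⟨Ω, hΩ⟩ := exists_eq_sum_mul_sub_mul (A.extDeriv_skew (θ α)) he vanishes
  exact ⟨Ω, funext₂ fun S T => (hΩ S T).trans (sum_wedge_apply Ω θ S T).symm⟩

theorem apply_localBracket_eq_zero {θ Ω : ι → OneForm m p (h *ᵖ F) U} {α : ι}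
    (hΩ : A.extDeriv U (θ α) = ∑ β, wedge (Ω β) (θ β))
    {S T : localSections m p (h *ᵖ F) U} (hS : ∀ β, θ β S = 0) (hT : ∀ β, θ β T = 0) :
    θ α (A.localBracket U S T) = 0 := by
  rw [← neg_eq_zero, ← A.extDeriv_of_apply_eq_zero (hS α) (hT α), hΩ, sum_wedge_apply]
  simp only [hS, hT, mul_zero, sub_zero, Finset.sum_const_zero]

theorem involutiveOn_iff_exists_extDeriv_eq_sum_wedge (hU : IsBundleChartDomain m p (h *ᵖ F) U)
    (Θ : Module.Basis ι (SmoothFun m U) (E.annihilator U)) :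
    A.InvolutiveOn E U ↔ ∃ Ω : ι → ι → OneForm m p (h *ᵖ F) U,
      ∀ α, A.extDeriv U (Θ α).1 = ∑ β, wedge (Ω α β) (Θ β).1 := by
  classical
  have := E.isReflexive_quotient_sections hU
  simp only [InvolutiveOn, mem_iff_forall_basis_dualAnnihilator_eq_zero Θ]
  constructor
  · intro hE
    obtain ⟨e, he⟩ := exists_dual_family_of_basis_dualAnnihilator Θ
    choose Ω hΩ using fun α => A.exists_extDeriv_eq_sum_wedge he fun S T hS hT => hE S hS T hT α
    exact ⟨Ω, hΩ⟩
  · rintro ⟨Ω, hΩ⟩ S hS T hT α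
    exact A.apply_localBracket_eq_zero (θ := fun β => (Θ β).1) (hΩ α) hS hT

end GeneralizedLieAlgebroid

end Pullback

end GenLie

theorem mainTheorem9_general {m n p r : ℕ} {M N : Type*}
    [TopologicalSpace M] [ChartedSpace (EuclideanSpace ℝ (Fin m)) M] [IsManifold (𝓡 m) ∞ M]
    [T2Space M]
    [TopologicalSpace N] [ChartedSpace (EuclideanSpace ℝ (Fin n)) N] [IsManifold (𝓡 n) ∞ N]
    {F : N → Type*} [∀ y, AddCommGroup (F y)] [∀ y, Module ℝ (F y)]
    [∀ y, TopologicalSpace (F y)] [TopologicalSpace (TotalSpace (EuclideanSpace ℝ (Fin p)) F)]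
    [FiberBundle (EuclideanSpace ℝ (Fin p)) F] [VectorBundle ℝ (EuclideanSpace ℝ (Fin p)) F]
    [ContMDiffVectorBundle ∞ (EuclideanSpace ℝ (Fin p)) F (𝓡 n)]
    {h : M ≃ₘ⟮𝓡 m, 𝓡 n⟯ N} {η : N ≃ₘ⟮𝓡 n, 𝓡 m⟯ M}
    (A : GenLie.GeneralizedLieAlgebroid p F h η)
    (E : GenLie.VectorSubbundle m p (h *ᵖ F) r)
    {κ : Type*} {U : κ → Opens M} (hU_cover : ⨆ i, U i = ⊤)
    (hU_bundle : ∀ i, GenLie.IsBundleChartDomain m p (h *ᵖ F) (U i))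
    {ι : κ → Type*} [∀ i, Fintype (ι i)]
    (Θ : ∀ i, Module.Basis (ι i) (GenLie.SmoothFun m (U i)) (E.annihilator (U i))) :
    A.Involutive E ↔
      ∀ i, ∃ Ω : ι i → ι i → GenLie.OneForm m p (h *ᵖ F) (U i),
        ∀ α, A.extDeriv (U i) (Θ i α).1 = ∑ β, GenLie.wedge (Ω α β) (Θ i β).1 :=
  (A.involutive_iff_forall_involutiveOn E hU_cover).trans <| forall_congr' fun i =>
    A.involutiveOn_iff_exists_extDeriv_eq_sum_wedge E (hU_bundle i) (Θ i)

theorem mainTheorem9 {m n p r : ℕ} {M N : Type*}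
    [TopologicalSpace M] [ChartedSpace (EuclideanSpace ℝ (Fin m)) M] [IsManifold (𝓡 m) ∞ M]
    [T2Space M]
    [TopologicalSpace N] [ChartedSpace (EuclideanSpace ℝ (Fin n)) N] [IsManifold (𝓡 n) ∞ N]
    (F : N → Type*) [∀ y, AddCommGroup (F y)] [∀ y, Module ℝ (F y)]
    [∀ y, TopologicalSpace (F y)] [TopologicalSpace (TotalSpace (EuclideanSpace ℝ (Fin p)) F)]
    [FiberBundle (EuclideanSpace ℝ (Fin p)) F] [VectorBundle ℝ (EuclideanSpace ℝ (Fin p)) F]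
    [ContMDiffVectorBundle ∞ (EuclideanSpace ℝ (Fin p)) F (𝓡 n)]
    (h : M ≃ₘ⟮𝓡 m, 𝓡 n⟯ N) (η : N ≃ₘ⟮𝓡 n, 𝓡 m⟯ M)
    (A : GenLie.GeneralizedLieAlgebroid p F h η)
    (E : GenLie.VectorSubbundle m p (h *ᵖ F) r)
    (𝒜 : Set (OpenPartialHomeomorph M (EuclideanSpace ℝ (Fin m))))
    (h𝒜 : ∀ c ∈ 𝒜, c ∈ IsManifold.maximalAtlas (𝓡 m) ∞ M)
    (h𝒜_bundle : ∀ c ∈ 𝒜, GenLie.IsBundleChartDomain m p (h *ᵖ F) ⟨c.source, c.open_source⟩)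
    (h𝒜_cover : ∀ x : M, ∃ c ∈ 𝒜, x ∈ c.source)
    (Θ : ∀ c : 𝒜, Module.Basis (Fin (p - r)) (GenLie.SmoothFun m ⟨c.1.source, c.1.open_source⟩)
      (E.annihilator ⟨c.1.source, c.1.open_source⟩)) :
    A.Involutive E ↔
      ∀ c : 𝒜, ∃ Ω : Fin (p - r) → Fin (p - r) →
          GenLie.OneForm m p (h *ᵖ F) ⟨c.1.source, c.1.open_source⟩,
        ∀ α, A.extDeriv ⟨c.1.source, c.1.open_source⟩ (Θ c α).1 =
          ∑ β, GenLie.wedge (Ω α β) (Θ c β).1 := by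
  refine mainTheorem9_general A E (U := fun c : 𝒜 => ⟨c.1.source, c.1.open_source⟩) ?_
    (fun c => h𝒜_bundle c c.2) Θ
  exact eq_top_iff.2 fun x _ => Opens.mem_iSup.2 <|
    let ⟨c, hc, hx⟩ := h𝒜_cover x; ⟨⟨c, hc⟩, hx⟩
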